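/- Let $V$ be a finite node set and let $H=(V,E,\mathcal W)$ be a submodular hypergraph: each hyperedge $e\subseteq V$ carries a scale $\vartheta_e>0$ and a submodular function $w_e:2^e\to[0,1]$ with $w_e(\emptyset)=w_e(e)=0$ and $\max_{A\subseteq e} w_e(A)=1$ (so $\vartheta_e w_e$ is the cut-cost of $e$ and $\vartheta_e$ its maximum), extended to $A\subseteq V$ by $w_e(A)=w_e(A\cap e)$. Put $d_v=\sum_{e\ni v}\vartheta_e$, $\mathrm{vol}(A)=\sum_{v\in A}d_v$, $\mathrm{vol}(\partial A)=\sum_{e}\vartheta_e w_e(A)$, and, if $\mathrm{vol}(A)$ and $\mathrm{vol}(V\setminus A)$ are positive, $\Phi(A)=\mathrm{vol}(\partial A)/\min\{\mathrm{vol}(A),\mathrm{vol}(V\setminus A)\}$. For $x\in\mathbb R^V$ let $f_e(x)=\max_{\rho\in B_e}\rho^Tx$, where $B_e=\{\rho\in\mathbb R^V:\sum_{v\in A}\rho_v\le w_e(A)\ \forall A\subseteq V,\ \sum_{v\in V}\rho_v=w_e(V)\}$. Let $p\ge 2$, $1/p+1/q=1$, $\alpha,\beta\in(0,1]$, and let $S,C\subseteq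 V$ satisfy $\mathrm{vol}(C)>0$, $\mathrm{vol}(V\setminus C)>0$, $\mathrm{vol}(S\cap C)\ge\alpha\,\mathrm{vol}(C)$ and $\mathrm{vol}(S\cap C)\ge\beta\,\mathrm{vol}(S)$. Let $\delta=3/\alpha$, let $\Delta_v=\delta d_v$ for $v\in S$ and $\Delta_v=0$ for $v\notin S$, and let $0\le\sigma\le\beta\Phi(C)/3$. Let $\hat x$ be an optimal solution of the dual hyper-flow diffusion problem $$\max_{x\in\mathbb R^V_{\ge0}}\ (\Delta-d)^Tx-\frac1q\sum_{e\in E}\vartheta_e f_e(x)^q-\frac{\sigma}{q}\sum_{v\in V}d_vx_v^q ,$$ and let $S_h=\{v\in V:\hat x_v\ge h\}$. Then there is $h>0$ such that $\mathrm{vol}(S_h)>0$ and $$\frac{\mathrm{vol}(\partial S_h)}{\mathrm{vol}(S_h)}\le\frac{12\,\Phi(C)^{1/q}}{\alpha\beta},$$ so that $\Phi(S_h)\le 12\,\Phi(C)^{1/q}/(\alpha\beta)$ whenever $\mathrm{vol}(S_h)\le\mathrm{vol}(V\setminus S_h)$. If moreover $\sigma=0$, or the total source mass $\sum_v\Delta_v$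 is at most the total sink capacity $\mathrm{vol}(V)$, then $h$ can be chosen so that also $\mathrm{vol}(V\setminus S_h)>0$ and $$\Phi(S_h)\le\frac{12\,\Phi(C)^{1/q}}{\alpha\beta}.$$ For $p=q=2$ the bound is $12\sqrt{\Phi(C)}/(\alpha\beta)$; it does not depend on the hyperedge sizes. -/

import Mathlib

/-- A finite submodular hypergraph with node type `V` and hyperedges indexed by `E`.
The cut-cost of `e` is `ϑ e * w e`: the set function `w e` is normalised to have maximum `1`, and
`ϑ e > 0` is the maximum of the cut-cost. As usual `w e` is extended from subsets of
the hyperedge to all node sets by `w e A = w e (A ∩ edge e)`. -/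
structure SubmodularHypergraph (V E : Type*) [DecidableEq V] where
  /-- the node set of a hyperedge -/
  edge : E → Finset V
  /-- the maximal cut-cost of a hyperedge -/
  ϑ : E → ℝ
  /-- the normalised cut-cost function of a hyperedge -/
  w : E → Finset V → ℝ
  ϑ_pos : ∀ e, 0 < ϑ e
  w_inter : ∀ e A, w e (A ∩ edge e) = w e A
  w_nonneg : ∀ e A, 0 ≤ w e A
  w_le_one : ∀ e A, w e A ≤ 1
  exists_w_eq_one : ∀ e, ∃ A, w e A = 1
  w_empty : ∀ e, w e ∅ = 0
  w_edge : ∀ e, w e (edge e) = 0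
  submodular : ∀ e A B, w e (A ∪ B) + w e (A ∩ B) ≤ w e A + w e B

namespace SubmodularHypergraph

variable {V E : Type*} [Fintype V] [DecidableEq V] [Fintype E] (H : SubmodularHypergraph V E)

/-- The degree `d_v`, the sum of `ϑ_e` over the hyperedges `e` that contain `v`. -/
noncomputable def deg (v : V) : ℝ := ∑ e : E, if v ∈ H.edge e then H.ϑ e else 0

/-- The volume of a node set. -/
noncomputable def vol (A : Finset V) : ℝ := ∑ v ∈ A, H.deg v

/-- The cut-size `vol(∂A)`. Hyperedges that do not cross `A` have `w e A = 0`. -/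
noncomputable def cutSize (A : Finset V) : ℝ := ∑ e : E, H.ϑ e * H.w e A

/-- The conductance `Φ(A)`; meaningful if `A` and its complement have positive volume. -/
noncomputable def conductance (A : Finset V) : ℝ :=
  H.cutSize A / min (H.vol A) (H.vol Aᶜ)

/-- The base polytope `B_e` of the cut-cost `w_e`. -/
def basePolytope (e : E) : Set (V → ℝ) :=
  {ρ | (∀ A : Finset V, ∑ v ∈ A, ρ v ≤ H.w e A) ∧ ∑ v, ρ v = H.w e Finset.univ}

/-- The support function `f_e` of the base polytope (the polytope is nonempty and compact,
so this supremum is a maximum). -/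
noncomputable def suppFun (e : E) (x : V → ℝ) : ℝ :=
  sSup ((fun ρ : V → ℝ => ∑ v, ρ v * x v) '' H.basePolytope e)

/-- The source mass `Δ`: `δ * d_v` on the seed set `S` and `0` elsewhere. -/
noncomputable def source (S : Finset V) (δ : ℝ) (v : V) : ℝ := if v ∈ S then δ * H.deg v else 0

/-- The objective function of the dual diffusion problem with `ℓ_q` penalty. -/
noncomputable def dualObjective (q σ : ℝ) (Δ x : V → ℝ) : ℝ :=
  ∑ v, (Δ v - H.deg v) * x v
    - 1 / q * ∑ e, H.ϑ e * H.suppFun e x ^ q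
    - σ / q * ∑ v, H.deg v * x v ^ q

/-- `x` is an optimal solution of the dual diffusion problem, the maximization of the dual
objective over nonnegative vectors. -/
def IsDualOptimal (q σ : ℝ) (Δ x : V → ℝ) : Prop :=
  (∀ v, 0 ≤ x v) ∧
    ∀ y : V → ℝ, (∀ v, 0 ≤ y v) → H.dualObjective q σ Δ y ≤ H.dualObjective q σ Δ x

end SubmodularHypergraph

/-- The sweep set `S_h = {v | x_v ≥ h}`. -/
noncomputable def sweepSet {V : Type*} [Fintype V] (x : V → ℝ) (h : ℝ) : Finset V :=
  Finset.univ.filter (fun v => h ≤ x v)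

/-! Write `N` for the penalty Σ ϑ_e f_e(x)^q + σ Σ d_v x_v^q of the optimum `x`, and M = Σ d_v |x_v
- m|^q for a level `m`. Scaling `x` shows that the linear part of the objective equals `N`, so the
optimal value is N/p; comparison with multiples of the indicator of `C` then gives N Φ^(p-1) ≥ 2
vol(C). Hölder bounds the linear part, hence `N`, by δ vol(S)^(1/p) M^(1/q). If all sweep sets
violated the bound κ = 12 Φ^(1/q)/(αβ), a Cheeger inequality would give κ M ≤ q N^(1/q) M^(1/p).
These three estimates are incompatible (`cheeger_estimate_false`).

For the Cheeger inequality (`cheeger_sweep`), a greedy base tight on every sweep set gives f_e(x) =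
∫ w_e(S_h) dh, and cut sizes are integrated against q|h - m|^(q-1). On a cut hyperedge this weight
is controlled by the ℓ_q mass of x - m on `e`; summed over hyperedges, this mass produces exactly
the degrees, so hyperedge sizes never enter.

The choice m = 0 bounds the cut relative to vol(S_h). For conductance `m` is a median level, so the
volume compared with is that of the smaller side. Centring the linear part at `m` loses nothing
because the source mass is at most the sink capacity, which is automatic for σ = 0. -/

set_option linter.unusedSectionVars false

/-! ### Layer-cake formula and greedy bases. -/

open MeasureTheory in
/-- Layer-cake formula for weighted sums over sweep sets. -/
theorem sweepSet_layer_cake {V : Type*} [Fintype V] (x c : V → ℝ) (hx : ∀ v, 0 ≤ x v)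
    {φ : ℝ → ℝ} (hφ : Continuous φ) {T : ℝ} (hT : 0 ≤ T) :
    IntervalIntegrable (fun h => φ h * ∑ v ∈ sweepSet x h, c v) volume 0 T ∧
      ∫ h in (0 : ℝ)..T, φ h * ∑ v ∈ sweepSet x h, c v
        = ∑ v, c v * ∫ h in (0 : ℝ)..min (x v) T, φ h := by
  have hfun : (fun h => φ h * ∑ v ∈ sweepSet x h, c v)
      = fun h => ∑ v, c v * (Set.Iic (x v)).indicator φ h := by
    funext h
    simp only [sweepSet, Finset.sum_filter, Finset.mul_sum, Set.indicator, Set.mem_Iic]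
    refine Finset.sum_congr rfl fun v _ => ?_
    split_ifs <;> ring
  have hint : ∀ v, IntervalIntegrable (fun h => c v * (Set.Iic (x v)).indicator φ h)
      volume 0 T := by
    intro v
    have h1 : IntegrableOn φ (Set.Ioc 0 T) volume :=
      (intervalIntegrable_iff_integrableOn_Ioc_of_le hT).1 (hφ.intervalIntegrable 0 T)
    have h2 : IntervalIntegrable ((Set.Iic (x v)).indicator φ) volume 0 T :=
      (intervalIntegrable_iff_integrableOn_Ioc_of_le hT).2 (h1.indicator measurableSet_Iic)
    exact h2.const_mul _
  refine ⟨?_, ?_⟩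
  · rw [hfun]
    have := IntervalIntegrable.sum (μ := volume) (a := 0) (b := T) Finset.univ
      (f := fun v h => c v * (Set.Iic (x v)).indicator φ h) (fun v _ => hint v)
    have hsum : (∑ v, fun h => c v * (Set.Iic (x v)).indicator φ h)
        = fun h => ∑ v, c v * (Set.Iic (x v)).indicator φ h := by
      funext h
      simp
    rwa [hsum] at this
  · rw [hfun, intervalIntegral.integral_finsetSum fun v _ => hint v]
    refine Finset.sum_congr rfl fun v _ => ?_
    rw [intervalIntegral.integral_const_mul, intervalIntegral.integral_of_le hT,
      intervalIntegral.integral_of_le (le_min (hx v) hT), setIntegral_indicator measurableSet_Iic,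
      Set.Ioc_inter_Iic, min_comm T]

/-- The greedy algorithm of Edmonds: a submodular function has a base which is tight on all sweep
sets of a given vector. -/
theorem exists_greedy_base {V : Type*} [DecidableEq V] (w : Finset V → ℝ) (hw0 : w ∅ = 0)
    (hw : ∀ A B, w (A ∪ B) + w (A ∩ B) ≤ w A + w B) (x : V → ℝ) (U : Finset V) :
    ∃ ρ : V → ℝ, (∀ A ⊆ U, ∑ v ∈ A, ρ v ≤ w A) ∧ ∑ v ∈ U, ρ v = w U ∧
      ∀ h : ℝ, ∑ v ∈ U.filter (fun v => h ≤ x v), ρ v = w (U.filter (fun v => h ≤ x v)) := by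
  induction U using Finset.induction_on_min_value x with
  | empty =>
    refine ⟨0, fun A hA => ?_, by simp [hw0], fun h => by simp [hw0]⟩
    rw [Finset.subset_empty.1 hA]
    simp [hw0]
  -- Elements enter by decreasing `x`, so a level set of `insert a U` is either the whole set or a
  -- level set of `U`. The new element receives its marginal value.
  | insert a U ha hmin ih =>
    obtain ⟨ρ, h1, h2, h3⟩ := ih
    have hupd : ∀ A : Finset V, a ∉ A →
        ∑ v ∈ A, Function.update ρ a (w (insert a U) - w U) v = ∑ v ∈ A, ρ v := by
      intro A hA
      refine Finset.sum_congr rfl fun v hv => Function.update_of_ne ?_ _ _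
      rintro rfl
      exact hA hv
    have htot : ∑ v ∈ insert a U, Function.update ρ a (w (insert a U) - w U) v
        = w (insert a U) := by
      rw [Finset.sum_insert ha, hupd U ha, Function.update_self, h2]
      ring
    refine ⟨Function.update ρ a (w (insert a U) - w U), fun A hA => ?_, htot, fun h => ?_⟩
    · by_cases haA : a ∈ A
      · have hsub : A.erase a ⊆ U := by
          intro v hv
          exact (Finset.mem_insert.1 (hA (Finset.mem_of_mem_erase hv))).resolve_left
            (Finset.ne_of_mem_erase hv)
        have hun : A ∪ U = insert a U := by
          ext v
          have := @hA v
          simp only [Finset.mem_union, Finset.mem_insert] at this ⊢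
          constructor
          · rintro (h | h)
            · exact this h
            · exact Or.inr h
          · rintro (rfl | h)
            · exact Or.inl haA
            · exact Or.inr h
        have hin : A ∩ U = A.erase a := by
          ext v
          simp only [Finset.mem_inter, Finset.mem_erase]
          constructor
          · rintro ⟨h, h'⟩
            refine ⟨?_, h⟩
            rintro rfl
            exact ha h'
          · rintro ⟨h, h'⟩
            exact ⟨h', hsub (Finset.mem_erase.2 ⟨h, h'⟩)⟩
        -- Submodularity for `A` and `U`: the marginal of `a` over `U` is at most its marginal over
        -- `A.erase a`.
        have := hw A U
        rw [hun, hin] at this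
        rw [← Finset.add_sum_erase A _ haA, Function.update_self,
          hupd _ (Finset.notMem_erase a A)]
        linarith [h1 _ hsub]
      · rw [hupd A haA]
        refine h1 A fun v hv => ?_
        refine (Finset.mem_insert.1 (hA hv)).resolve_left ?_
        rintro rfl
        exact haA hv
    · by_cases hxa : h ≤ x a
      · rw [Finset.filter_true_of_mem]
        · exact htot
        · intro v hv
          rcases Finset.mem_insert.1 hv with rfl | hv
          · exact hxa
          · exact hxa.trans (hmin v hv)
      · rw [Finset.filter_insert, if_neg hxa, hupd _ (by simp [ha]), h3 h]

/-! ### Volumes, cuts and the support function. -/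

namespace SubmodularHypergraph

variable {V E : Type*} [Fintype V] [DecidableEq V] [Fintype E] (H : SubmodularHypergraph V E)

theorem w_univ (e : E) : H.w e Finset.univ = 0 := by
  rw [← H.w_inter, Finset.univ_inter, H.w_edge]

theorem deg_nonneg (v : V) : 0 ≤ H.deg v :=
  Finset.sum_nonneg fun e _ => by split_ifs <;> simp [(H.ϑ_pos e).le]

theorem vol_nonneg (A : Finset V) : 0 ≤ H.vol A :=
  Finset.sum_nonneg fun v _ => H.deg_nonneg v

theorem vol_mono {A B : Finset V} (h : A ⊆ B) : H.vol A ≤ H.vol B :=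
  Finset.sum_le_sum_of_subset_of_nonneg h fun v _ _ => H.deg_nonneg v

theorem vol_add_compl (A : Finset V) : H.vol A + H.vol Aᶜ = H.vol Finset.univ :=
  Finset.sum_add_sum_compl A _

theorem cutSize_nonneg (A : Finset V) : 0 ≤ H.cutSize A :=
  Finset.sum_nonneg fun e _ => mul_nonneg (H.ϑ_pos e).le (H.w_nonneg e A)

/-- Double counting: summing over hyperedges and their nodes gives degree weights. -/
theorem sum_edge_eq (u : V → ℝ) :
    ∑ e, H.ϑ e * ∑ v ∈ H.edge e, u v = ∑ v, H.deg v * u v := by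
  simp only [deg, Finset.sum_mul, Finset.mul_sum]
  rw [Finset.sum_comm]
  refine Finset.sum_congr rfl fun e _ => ?_
  rw [← Finset.sum_filter_add_sum_filter_not Finset.univ (fun v => v ∈ H.edge e)]
  rw [Finset.sum_eq_zero (s := Finset.univ.filter fun v => v ∉ H.edge e), add_zero]
  · refine Finset.sum_congr (by ext; simp) fun v hv => ?_
    simp [(Finset.mem_filter.1 hv).2]
  · intro v hv
    simp [(Finset.mem_filter.1 hv).2]

/-- By the layer-cake formula both sides are integrals over `h` of the mass of `sweepSet x h`; `ρ'`
gives it at most `w e`, and `ρ` exactly `w e`. -/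
theorem base_sum_le {e : E} {ρ ρ' : V → ℝ} {x : V → ℝ} (hx : ∀ v, 0 ≤ x v)
    (hρ : ∀ h, ∑ v ∈ sweepSet x h, ρ v = H.w e (sweepSet x h))
    (hρ' : ρ' ∈ H.basePolytope e) : ∑ v, ρ' v * x v ≤ ∑ v, ρ v * x v := by
  obtain ⟨T, hT⟩ : ∃ T, ∀ v, x v ≤ T := by
    refine ⟨∑ v, x v, fun v => ?_⟩
    exact Finset.single_le_sum (fun u _ => hx u) (Finset.mem_univ v)
  have hT0 : 0 ≤ max T 0 := le_max_right _ _
  have h1 := sweepSet_layer_cake x ρ hx (φ := fun _ => 1) continuous_const hT0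
  have h2 := sweepSet_layer_cake x ρ' hx (φ := fun _ => 1) continuous_const hT0
  have hmin : ∀ v, min (x v) (max T 0) = x v :=
    fun v => min_eq_left ((hT v).trans (le_max_left _ _))
  have := intervalIntegral.integral_mono_on hT0 h2.1 h1.1
    (fun h _ => by rw [one_mul, one_mul, hρ h]; exact hρ'.1 _)
  rw [h1.2, h2.2] at this
  simpa [hmin] using this

/-- A base that is tight on all sweep sets of `x` attains the support function at `x`. -/
theorem suppFun_eq {e : E} {ρ : V → ℝ} {x : V → ℝ} (hx : ∀ v, 0 ≤ x v)
    (hρB : ρ ∈ H.basePolytope e)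
    (hρ : ∀ h, ∑ v ∈ sweepSet x h, ρ v = H.w e (sweepSet x h)) :
    H.suppFun e x = ∑ v, ρ v * x v := by
  have : IsGreatest ((fun ρ : V → ℝ => ∑ v, ρ v * x v) '' H.basePolytope e)
      (∑ v, ρ v * x v) := by
    refine ⟨⟨ρ, hρB, rfl⟩, ?_⟩
    rintro _ ⟨ρ', hρ', rfl⟩
    exact H.base_sum_le hx hρ hρ'
  exact this.csSup_eq

theorem exists_base (e : E) (x : V → ℝ) : ∃ ρ ∈ H.basePolytope e,
    ∀ h, ∑ v ∈ sweepSet x h, ρ v = H.w e (sweepSet x h) := by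
  obtain ⟨ρ, h1, h2, h3⟩ :=
    exists_greedy_base (H.w e) (H.w_empty e) (H.submodular e) x Finset.univ
  exact ⟨ρ, ⟨fun A => h1 A (Finset.subset_univ A), h2⟩, h3⟩

theorem suppFun_nonneg (e : E) {x : V → ℝ} (hx : ∀ v, 0 ≤ x v) : 0 ≤ H.suppFun e x := by
  obtain ⟨ρ, hB, hρ⟩ := H.exists_base e x
  rw [H.suppFun_eq hx hB hρ]
  obtain ⟨T, hT⟩ : ∃ T, ∀ v, x v ≤ T :=
    ⟨∑ v, x v, fun v => Finset.single_le_sum (fun u _ => hx u) (Finset.mem_univ v)⟩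
  have h1 := sweepSet_layer_cake x ρ hx (φ := fun _ => 1) continuous_const
    (le_max_right T 0)
  have hmin : ∀ v, min (x v) (max T 0) = x v :=
    fun v => min_eq_left ((hT v).trans (le_max_left _ _))
  have h2 : 0 ≤ ∫ h in (0 : ℝ)..max T 0, (fun _ => (1 : ℝ)) h * ∑ v ∈ sweepSet x h, ρ v :=
    intervalIntegral.integral_nonneg (le_max_right T 0) fun h _ => by
      rw [one_mul, hρ h]
      exact H.w_nonneg _ _
  rw [h1.2] at h2
  simpa [hmin] using h2

open scoped Pointwise in
theorem suppFun_smul (e : E) (x : V → ℝ) {t : ℝ} (ht : 0 ≤ t) :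
    H.suppFun e (fun v => t * x v) = t * H.suppFun e x := by
  have : (fun ρ : V → ℝ => ∑ v, ρ v * (t * x v)) '' H.basePolytope e
      = t • ((fun ρ : V → ℝ => ∑ v, ρ v * x v) '' H.basePolytope e) := by
    rw [← Set.image_smul, Set.image_image]
    refine Set.image_congr' fun ρ => ?_
    simp only [smul_eq_mul, Finset.mul_sum]
    exact Finset.sum_congr rfl fun v _ => by ring
  unfold suppFun
  rw [this, Real.sSup_smul_of_nonneg ht, smul_eq_mul]

theorem suppFun_add_const (e : E) (x : V → ℝ) (t : ℝ) :
    H.suppFun e (fun v => x v + t) = H.suppFun e x := by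
  unfold suppFun
  congr 1
  refine Set.image_congr fun ρ hρ => ?_
  simp only [mul_add, Finset.sum_add_distrib, ← Finset.sum_mul]
  rw [hρ.2, H.w_univ]
  ring

theorem suppFun_indicator_le (e : E) (C : Finset V) :
    H.suppFun e (fun v => if v ∈ C then 1 else 0) ≤ H.w e C := by
  refine csSup_le ?_ ?_
  · obtain ⟨ρ, hB, -⟩ := H.exists_base e fun v => if v ∈ C then 1 else 0
    exact ⟨_, ρ, hB, rfl⟩
  · rintro _ ⟨ρ, hρ, rfl⟩
    simpa using hρ.1 C

/-- Lowering the values on a sweep set down to the next smaller level does not increase the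
support function. -/
theorem suppFun_sub_le (e : E) {x : V → ℝ} (hx : ∀ v, 0 ≤ x v) {a m : ℝ} (ha : 0 ≤ a)
    (ham : a ≤ m) (hgap : ∀ v, x v < m → x v ≤ a) :
    H.suppFun e (fun v => x v - if m ≤ x v then m - a else 0) ≤ H.suppFun e x := by
  -- Since `x` has no value strictly between `a` and `m`, the lowered vector has only sweep sets of
  -- `x`. The same base is thus optimal for both vectors, and the values differ by (m - a) w_e(S_m)
  -- ≥ 0.
  obtain ⟨ρ, hB, hρ⟩ := H.exists_base e x
  rw [H.suppFun_eq hx hB hρ, H.suppFun_eq (ρ := ρ) _ hB]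
  · simp only [mul_sub, Finset.sum_sub_distrib, mul_ite, mul_zero, ← Finset.sum_filter,
      ← Finset.sum_mul]
    have h1 := hρ m
    unfold sweepSet at h1
    have h2 := H.w_nonneg e (Finset.univ.filter fun v => m ≤ x v)
    rw [← mul_sub, h1]
    nlinarith [mul_nonneg h2 (sub_nonneg.2 ham)]
  · intro h
    rcases le_or_gt h a with hh | hh
    · have : sweepSet (fun v => x v - if m ≤ x v then m - a else 0) h = sweepSet x h := by
        ext v
        simp only [sweepSet, Finset.mem_filter, Finset.mem_univ, true_and]
        split_ifs with hv
        · exact ⟨fun _ => by linarith, fun _ => by linarith⟩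
        · simp
      rw [this, hρ]
    · have : sweepSet (fun v => x v - if m ≤ x v then m - a else 0) h
          = sweepSet x (h + (m - a)) := by
        ext v
        simp only [sweepSet, Finset.mem_filter, Finset.mem_univ, true_and]
        split_ifs with hv
        · exact ⟨fun _ => by linarith, fun _ => by linarith⟩
        · have := hgap v (not_le.1 hv)
          exact ⟨fun _ => by linarith, fun _ => by linarith⟩
      rw [this, hρ]
  · intro v
    split_ifs with hv
    · linarith
    · linarith [hx v]

end SubmodularHypergraph

/-! ### Hölder's inequality and one-dimensional integrals. -/

/-- Hölder's inequality for weighted finite sums. -/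
theorem sum_weight_mul_le_Lp_mul_Lq {ι : Type*} [Fintype ι] {p q : ℝ} (hpq : p.HolderConjugate q)
    {w a b : ι → ℝ} (hw : ∀ i, 0 ≤ w i) (ha : ∀ i, 0 ≤ a i) (hb : ∀ i, 0 ≤ b i) :
    ∑ i, w i * (a i * b i) ≤ (∑ i, w i * a i ^ p) ^ (1 / p) * (∑ i, w i * b i ^ q) ^ (1 / q) := by
  have h := Real.inner_le_Lp_mul_Lq_of_nonneg Finset.univ hpq
    (f := fun i => w i ^ (1 / p) * a i) (g := fun i => w i ^ (1 / q) * b i)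
    (fun i _ => mul_nonneg (Real.rpow_nonneg (hw i) _) (ha i))
    (fun i _ => mul_nonneg (Real.rpow_nonneg (hw i) _) (hb i))
  have hroot : ∀ {r : ℝ}, r ≠ 0 → ∀ i, ∀ c : ℝ, 0 ≤ c →
      (w i ^ (1 / r) * c) ^ r = w i * c ^ r := by
    intro r hr i c hc
    rw [Real.mul_rpow (Real.rpow_nonneg (hw i) _) hc, ← Real.rpow_mul (hw i),
      one_div_mul_cancel hr, Real.rpow_one]
  have h1 : ∀ i, (w i ^ (1 / p) * a i) * (w i ^ (1 / q) * b i) = w i * (a i * b i) := by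
    intro i
    have : w i ^ (1 / p) * w i ^ (1 / q) = w i := by
      rcases (hw i).eq_or_lt with h0 | h0
      · rw [← h0, Real.zero_rpow (by simpa using hpq.ne_zero), zero_mul]
      · rw [← Real.rpow_add h0, one_div, one_div, hpq.inv_add_inv_eq_one, Real.rpow_one]
    calc _ = (w i ^ (1 / p) * w i ^ (1 / q)) * (a i * b i) := by ring
      _ = _ := by rw [this]
  simp only [h1, fun i => hroot hpq.ne_zero i _ (ha i), fun i => hroot hpq.symm.ne_zero i _ (hb i)]
    at h
  exact h

theorem continuous_mul_abs_sub_rpow {q : ℝ} (hq : 1 < q) (m : ℝ) :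
    Continuous fun h : ℝ => q * |h - m| ^ (q - 1) :=
  continuous_const.mul
    ((continuous_id.sub continuous_const).abs.rpow_const fun _ => Or.inr (by linarith))

theorem integral_mul_abs_sub_left_rpow {q : ℝ} (hq : 1 < q) {a b : ℝ} (hab : a ≤ b) :
    ∫ h in a..b, q * |h - a| ^ (q - 1) = (b - a) ^ q := by
  rw [intervalIntegral.integral_comp_sub_right (fun u => q * |u| ^ (q - 1)) a, sub_self]
  have : ∫ u in (0 : ℝ)..(b - a), q * |u| ^ (q - 1)
      = ∫ u in (0 : ℝ)..(b - a), q * u ^ (q - 1) := by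
    refine intervalIntegral.integral_congr fun u hu => ?_
    rw [Set.uIcc_of_le (by linarith)] at hu
    simp only [abs_of_nonneg hu.1]
  rw [this, intervalIntegral.integral_const_mul, integral_rpow (Or.inl (by linarith))]
  rw [sub_add_cancel, Real.zero_rpow (by linarith)]
  field_simp
  ring

theorem integral_mul_abs_sub_right_rpow {q : ℝ} (hq : 1 < q) {a b : ℝ} (hab : a ≤ b) :
    ∫ h in a..b, q * |h - b| ^ (q - 1) = (b - a) ^ q := by
  have h1 := integral_mul_abs_sub_left_rpow hq (neg_le_neg hab)
  rw [← intervalIntegral.integral_comp_neg] at h1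
  have h2 : -a - -b = b - a := by ring
  rw [h2] at h1
  rw [← h1]
  refine intervalIntegral.integral_congr fun u _ => ?_
  rw [show -u - -b = -(u - b) by ring, abs_neg]

/-- The integral between `x` and `m` is expressed by integrals starting at 0, the form the
layer-cake formula delivers: complements of sweep sets count below `m`, sweep sets above. -/
theorem integral_two_sided_rpow {q : ℝ} (hq : 1 < q) (x m : ℝ) :
    (∫ h in (0 : ℝ)..m, q * |h - m| ^ (q - 1)) + (∫ h in (0 : ℝ)..x, q * |h - m| ^ (q - 1))
      - 2 * ∫ h in (0 : ℝ)..min x m, q * |h - m| ^ (q - 1) = |x - m| ^ q := by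
  have hint := (continuous_mul_abs_sub_rpow hq m).intervalIntegrable (μ := MeasureTheory.volume)
  rcases le_total x m with h | h
  · rw [min_eq_left h, abs_sub_comm, abs_of_nonneg (sub_nonneg.2 h),
      ← integral_mul_abs_sub_right_rpow hq h,
      ← intervalIntegral.integral_interval_sub_left (hint 0 m) (hint 0 x)]
    ring
  · rw [min_eq_right h, abs_of_nonneg (sub_nonneg.2 h),
      ← integral_mul_abs_sub_left_rpow hq h,
      ← intervalIntegral.integral_interval_sub_left (hint 0 x) (hint 0 m)]
    ring

/-! ### Cheeger inequality for sweep sets. -/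

namespace SubmodularHypergraph

variable {V E : Type*} [Fintype V] [DecidableEq V] [Fintype E] (H : SubmodularHypergraph V E)

/-- If the sweep set at level `h` cuts a hyperedge, then `|h - m|` is at most the `ℓ_q`-norm of
`x - m` on this hyperedge. -/
theorem abs_sub_rpow_mul_w_le {p q : ℝ} (hpq : p.HolderConjugate q) (e : E) (x : V → ℝ)
    (m h : ℝ) :
    |h - m| ^ (q - 1) * H.w e (sweepSet x h)
      ≤ (∑ v ∈ H.edge e, |x v - m| ^ q) ^ (1 / p) * H.w e (sweepSet x h) := by
  by_cases hw : H.w e (sweepSet x h) = 0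
  · simp [hw]
  refine mul_le_mul_of_nonneg_right ?_ (H.w_nonneg _ _)
  have hq0 : 0 < q := hpq.symm.pos
  have key : ∀ u ∈ H.edge e, |h - m| ≤ |x u - m| →
      |h - m| ^ (q - 1) ≤ (∑ v ∈ H.edge e, |x v - m| ^ q) ^ (1 / p) := by
    intro u hu hle
    have h1 : |h - m| ^ q ≤ ∑ v ∈ H.edge e, |x v - m| ^ q :=
      (Real.rpow_le_rpow (abs_nonneg _) hle hq0.le).trans
        (Finset.single_le_sum (f := fun v => |x v - m| ^ q)
          (fun v _ => Real.rpow_nonneg (abs_nonneg _) _) hu)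
    have h2 := Real.rpow_le_rpow (Real.rpow_nonneg (abs_nonneg _) _) h1 hpq.one_div_nonneg
    rwa [← Real.rpow_mul (abs_nonneg _), mul_one_div, hpq.symm.div_conj_eq_sub_one] at h2
  have hlow : ∃ u ∈ H.edge e, x u < h := by
    by_contra! hcon
    refine hw ?_
    rw [← H.w_inter, Finset.inter_eq_right.2, H.w_edge]
    intro u hu
    simpa [sweepSet] using hcon u hu
  have hhigh : ∃ u ∈ H.edge e, h ≤ x u := by
    by_contra! hcon
    refine hw ?_
    have : sweepSet x h ∩ H.edge e = ∅ := by
      refine Finset.eq_empty_of_forall_notMem fun u hu => ?_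
      simp only [sweepSet, Finset.mem_inter, Finset.mem_filter, Finset.mem_univ, true_and] at hu
      exact (hcon u hu.2).not_ge hu.1
    rw [← H.w_inter, this, H.w_empty]
  obtain ⟨u, hu, hul⟩ := hlow
  obtain ⟨u', hu', hul'⟩ := hhigh
  -- A cut hyperedge has nodes on both sides of `h`; the node on the side away from `m` is at least
  -- as far from `m` as `h` is.
  rcases le_total m h with hm | hm
  · refine key u' hu' ?_
    rw [abs_of_nonneg (by linarith), abs_of_nonneg (by linarith)]
    linarith
  · refine key u hu ?_
    rw [abs_of_nonpos (by linarith), abs_of_nonpos (by linarith)]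
    linarith

/-- Two-sided Cheeger-type inequality for the sweep sets of `x` around the level `m`. -/
theorem cheeger_sweep {p q : ℝ} (hpq : p.HolderConjugate q) {x : V → ℝ} (hx : ∀ v, 0 ≤ x v)
    {m κ : ℝ} (hm : 0 ≤ m)
    (hlow : ∀ h, 0 < h → h ≤ m → κ * H.vol (sweepSet x h)ᶜ ≤ H.cutSize (sweepSet x h))
    (hhigh : ∀ h, m < h → κ * H.vol (sweepSet x h) ≤ H.cutSize (sweepSet x h)) :
    κ * ∑ v, H.deg v * |x v - m| ^ q
      ≤ q * ((∑ e, H.ϑ e * H.suppFun e x ^ q) ^ (1 / q)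
          * (∑ v, H.deg v * |x v - m| ^ q) ^ (1 / p)) := by
  have hq : 1 < q := hpq.symm.lt
  choose ρ hB hρ using fun e => H.exists_base e x
  set φ : ℝ → ℝ := fun h => q * |h - m| ^ (q - 1) with hφdef
  have hφ : Continuous φ := continuous_mul_abs_sub_rpow hq m
  have hφ0 : ∀ h, 0 ≤ φ h := fun h =>
    mul_nonneg (by linarith) (Real.rpow_nonneg (abs_nonneg _) _)
  set T := m + ∑ v, x v with hTdef
  have hxT : ∀ v, x v ≤ T := fun v => by
    have := Finset.single_le_sum (f := x) (fun u _ => hx u) (Finset.mem_univ v)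
    linarith
  have hmT : m ≤ T := by
    have := Finset.sum_nonneg (s := Finset.univ) (f := x) fun u _ => hx u
    linarith
  have hT : 0 ≤ T := hm.trans hmT
  have hminT : ∀ v, min (x v) T = x v := fun v => min_eq_left (hxT v)
  -- These node weights turn the cut size of every sweep set into a modular sum, so the layer-cake
  -- formula applies to cuts as well as to volumes.
  set c : V → ℝ := fun v => ∑ e, H.ϑ e * ρ e v with hcdef
  have hcut : ∀ h, ∑ v ∈ sweepSet x h, c v = H.cutSize (sweepSet x h) := by
    intro h
    rw [hcdef, Finset.sum_comm]
    refine Finset.sum_congr rfl fun e _ => ?_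
    rw [← Finset.mul_sum, hρ]
  have hupper : ∑ v, c v * ∫ h in (0 : ℝ)..x v, φ h
      ≤ q * ∑ e, H.ϑ e * (H.suppFun e x * (∑ v ∈ H.edge e, |x v - m| ^ q) ^ (1 / p)) := by
    have hedge : ∀ e, ∑ v, ρ e v * ∫ h in (0 : ℝ)..x v, φ h
        ≤ q * (H.suppFun e x * (∑ v ∈ H.edge e, |x v - m| ^ q) ^ (1 / p)) := by
      intro e
      set K := (∑ v ∈ H.edge e, |x v - m| ^ q) ^ (1 / p)
      have h1 := sweepSet_layer_cake x (ρ e) hx hφ hT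
      have h2 := sweepSet_layer_cake x (ρ e) hx (φ := fun _ => q * K) continuous_const hT
      have h3 := intervalIntegral.integral_mono_on hT h1.1 h2.1 fun h _ => by
        rw [hρ e h, mul_assoc, mul_assoc]
        exact mul_le_mul_of_nonneg_left (H.abs_sub_rpow_mul_w_le hpq e x m h) (by linarith)
      rw [h1.2, h2.2] at h3
      simp only [hminT] at h3
      refine h3.trans (le_of_eq ?_)
      rw [H.suppFun_eq hx (hB e) (hρ e)]
      simp only [intervalIntegral.integral_const, sub_zero, smul_eq_mul, Finset.sum_mul,
        Finset.mul_sum]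
      exact Finset.sum_congr rfl fun v _ => by ring
    simp only [hcdef, Finset.sum_mul]
    rw [Finset.sum_comm, Finset.mul_sum]
    refine Finset.sum_le_sum fun e _ => ?_
    have := mul_le_mul_of_nonneg_left (hedge e) (H.ϑ_pos e).le
    calc _ = H.ϑ e * ∑ v, ρ e v * ∫ h in (0 : ℝ)..x v, φ h := by
          rw [Finset.mul_sum]
          exact Finset.sum_congr rfl fun v _ => by ring
      _ ≤ _ := this
      _ = _ := by ring
  have hlower : κ * ∑ v, H.deg v * |x v - m| ^ q ≤ ∑ v, c v * ∫ h in (0 : ℝ)..x v, φ h := by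
    have cT := sweepSet_layer_cake x c hx hφ hT
    have cm := sweepSet_layer_cake x c hx hφ hm
    have dT := sweepSet_layer_cake x H.deg hx hφ hT
    have dm := sweepSet_layer_cake x H.deg hx hφ hm
    have hsub : ∀ {f : ℝ → ℝ}, IntervalIntegrable f MeasureTheory.volume 0 T →
        IntervalIntegrable f MeasureTheory.volume m T := fun hf =>
      hf.mono_set (by
        rw [Set.uIcc_of_le hmT, Set.uIcc_of_le hT]
        exact Set.Icc_subset_Icc_left hm)
    have hφm := hφ.intervalIntegrable (μ := MeasureTheory.volume) 0 m
    have e1 := intervalIntegral.integral_mono_on_of_le_Ioo hm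
      (((hφm.mul_const (H.vol Finset.univ)).sub dm.1).const_mul κ) cm.1 fun h hh => by
        have h1 := mul_le_mul_of_nonneg_left (hlow h hh.1 hh.2.le) (hφ0 h)
        have h2 := H.vol_add_compl (sweepSet x h)
        rw [hcut]
        change κ * (φ h * H.vol Finset.univ - φ h * H.vol (sweepSet x h)) ≤ _
        rw [← h2]
        linarith
    have e2 := intervalIntegral.integral_mono_on_of_le_Ioo hmT
      ((hsub dT.1).const_mul κ) (hsub cT.1) fun h hh => by
        have h1 := mul_le_mul_of_nonneg_left (hhigh h hh.1) (hφ0 h)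
        rw [hcut]
        change κ * (φ h * H.vol (sweepSet x h)) ≤ _
        linarith
    rw [intervalIntegral.integral_const_mul,
      intervalIntegral.integral_sub (hφm.mul_const _) dm.1,
      intervalIntegral.integral_mul_const] at e1
    rw [intervalIntegral.integral_const_mul,
      ← intervalIntegral.integral_interval_sub_left cT.1 cm.1,
      ← intervalIntegral.integral_interval_sub_left dT.1 dm.1] at e2
    rw [cm.2, dm.2] at e1 e2
    rw [cT.2, dT.2] at e2
    simp only [hminT] at e2
    have hsum : ∑ v, H.deg v * |x v - m| ^ q
        = (∫ h in (0 : ℝ)..m, φ h) * H.vol Finset.univ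
          + ∑ v, H.deg v * (∫ h in (0 : ℝ)..x v, φ h)
          - 2 * ∑ v, H.deg v * ∫ h in (0 : ℝ)..min (x v) m, φ h := by
      rw [vol, Finset.mul_sum, Finset.mul_sum, ← Finset.sum_add_distrib,
        ← Finset.sum_sub_distrib]
      refine Finset.sum_congr rfl fun v _ => ?_
      rw [← integral_two_sided_rpow hq]
      ring
    rw [hsum]
    linarith
  -- Hölder over hyperedges with weights ϑ. The p-th power of the second factor is the ℓ_q mass on
  -- `e`, which double counting turns into degree weights.
  have hhold := sum_weight_mul_le_Lp_mul_Lq hpq.symm (w := H.ϑ) (a := fun e => H.suppFun e x)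
    (b := fun e => (∑ v ∈ H.edge e, |x v - m| ^ q) ^ (1 / p)) (fun e => (H.ϑ_pos e).le)
    (fun e => H.suppFun_nonneg e hx)
    (fun e => Real.rpow_nonneg (Finset.sum_nonneg fun v _ => Real.rpow_nonneg (abs_nonneg _) _) _)
  have hK : ∀ e, ((∑ v ∈ H.edge e, |x v - m| ^ q) ^ (1 / p)) ^ p
      = ∑ v ∈ H.edge e, |x v - m| ^ q := fun e => by
    rw [← Real.rpow_mul (Finset.sum_nonneg fun v _ => Real.rpow_nonneg (abs_nonneg _) _),
      one_div_mul_cancel hpq.ne_zero, Real.rpow_one]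
  simp only [hK] at hhold
  rw [H.sum_edge_eq fun v => |x v - m| ^ q] at hhold
  exact hlower.trans (hupper.trans (mul_le_mul_of_nonneg_left hhold (by linarith)))

end SubmodularHypergraph

/-! ### Consequences of dual optimality, and median levels. -/

namespace SubmodularHypergraph

variable {V E : Type*} [Fintype V] [DecidableEq V] [Fintype E] (H : SubmodularHypergraph V E)

/-- The `q`-homogeneous penalty of the dual diffusion problem, without the factor `1 / q`. -/
noncomputable def penalty (q σ : ℝ) (x : V → ℝ) : ℝ :=
  ∑ e, H.ϑ e * H.suppFun e x ^ q + σ * ∑ v, H.deg v * x v ^ q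

theorem dualObjective_eq (q σ : ℝ) (Δ x : V → ℝ) :
    H.dualObjective q σ Δ x = ∑ v, (Δ v - H.deg v) * x v - 1 / q * H.penalty q σ x := by
  unfold dualObjective penalty
  ring

theorem penalty_smul (q σ : ℝ) {x : V → ℝ} (hx : ∀ v, 0 ≤ x v) {t : ℝ} (ht : 0 ≤ t) :
    H.penalty q σ (fun v => t * x v) = t ^ q * H.penalty q σ x := by
  simp only [penalty, H.suppFun_smul _ x ht, Real.mul_rpow ht (H.suppFun_nonneg _ hx),
    fun v => Real.mul_rpow (z := q) ht (hx v), mul_add, Finset.mul_sum]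
  congr 1 <;> exact Finset.sum_congr rfl fun _ _ => by ring

variable {H}

/-- Stationarity of the dual optimum under scaling. -/
theorem IsDualOptimal.linear_eq_penalty {q σ : ℝ} (hq : 1 < q) {Δ x : V → ℝ}
    (hx : H.IsDualOptimal q σ Δ x) :
    ∑ v, (Δ v - H.deg v) * x v = H.penalty q σ x := by
  set L := ∑ v, (Δ v - H.deg v) * x v with hL
  set N := H.penalty q σ x with hN
  have hobj : ∀ t : ℝ, 0 ≤ t →
      H.dualObjective q σ Δ (fun v => t * x v) = t * L - 1 / q * (t ^ q * N) := by
    intro t ht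
    rw [dualObjective_eq, H.penalty_smul q σ hx.1 ht, hL, Finset.mul_sum]
    congr 1
    exact Finset.sum_congr rfl fun _ _ => by ring
  have hmax : IsLocalMax (fun t : ℝ => t * L - 1 / q * (t ^ q * N)) 1 := by
    filter_upwards [lt_mem_nhds (show (0 : ℝ) < 1 by norm_num)] with t ht
    have h1 := hx.2 (fun v => t * x v) fun v => mul_nonneg ht.le (hx.1 v)
    rw [hobj t ht.le, H.dualObjective_eq] at h1
    simpa using h1
  have hder : HasDerivAt (fun t : ℝ => t * L - 1 / q * (t ^ q * N))
      (1 * L - 1 / q * ((q * (1 : ℝ) ^ (q - 1)) * N)) 1 :=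
    ((hasDerivAt_id (1 : ℝ)).mul_const L).sub
      (((Real.hasDerivAt_rpow_const (Or.inl one_ne_zero)).mul_const N).const_mul _)
  have h0 := hmax.hasDerivAt_eq_zero hder
  rw [Real.one_rpow] at h0
  have hq0 : q ≠ 0 := by linarith
  field_simp at h0
  linarith

/-- Comparison of the dual optimum with multiples of the indicator vector of `C`. -/
theorem IsDualOptimal.indicator_le {p q σ : ℝ} (hpq : p.HolderConjugate q) {Δ x : V → ℝ}
    (hx : H.IsDualOptimal q σ Δ x) (C : Finset V) {t : ℝ} (ht : 0 ≤ t) :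
    t * ∑ v ∈ C, (Δ v - H.deg v) - 1 / q * (t ^ q * (H.cutSize C + σ * H.vol C))
      ≤ 1 / p * H.penalty q σ x := by
  have hq : 1 < q := hpq.symm.lt
  have h1 : ∀ v, 0 ≤ (fun v => if v ∈ C then (1 : ℝ) else 0) v := fun v => by
    simp only
    split_ifs <;> norm_num
  have h2 := hx.2 (fun v => t * if v ∈ C then 1 else 0) fun v => mul_nonneg ht (h1 v)
  rw [dualObjective_eq, dualObjective_eq, H.penalty_smul q σ h1 ht,
    hx.linear_eq_penalty hq] at h2
  -- As f_e(1_C) ≤ w_e(C) ≤ 1 and q > 1, the power `q` can be dropped; here the normalisation of w_e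
  -- matters.
  have h3 : H.penalty q σ (fun v => if v ∈ C then 1 else 0) ≤ H.cutSize C + σ * H.vol C := by
    refine add_le_add (Finset.sum_le_sum fun e _ => ?_) (le_of_eq ?_)
    · refine mul_le_mul_of_nonneg_left ?_ (H.ϑ_pos e).le
      have h4 := H.suppFun_indicator_le e C
      have h5 := H.suppFun_nonneg e h1
      exact (Real.rpow_le_self_of_le_one h5 (h4.trans (H.w_le_one e C)) hq.le).trans h4
    · congr 1
      have hq0 : q ≠ 0 := by linarith
      simp [Real.zero_rpow hq0, vol, apply_ite (fun y : ℝ => y ^ q)]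
  have h6 : ∑ v, (Δ v - H.deg v) * (t * if v ∈ C then 1 else 0)
      = t * ∑ v ∈ C, (Δ v - H.deg v) := by
    rw [Finset.mul_sum]
    simp [mul_comm]
  rw [h6] at h2
  have h7 : 1 / q * (t ^ q * H.penalty q σ (fun v => if v ∈ C then 1 else 0))
      ≤ 1 / q * (t ^ q * (H.cutSize C + σ * H.vol C)) :=
    mul_le_mul_of_nonneg_left (mul_le_mul_of_nonneg_left h3 (Real.rpow_nonneg ht _))
      hpq.symm.one_div_nonneg
  have h8 : 1 / p = 1 - 1 / q := by
    have := hpq.inv_add_inv_eq_one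
    rw [one_div, one_div]
    linarith
  rw [h8]
  linarith

/-- Without the penalty term on the nodes, a dual optimum exists only if the total source mass is
at most the total sink capacity. -/
theorem IsDualOptimal.sum_source_le {q : ℝ} {Δ x : V → ℝ} (hx : H.IsDualOptimal q 0 Δ x) :
    ∑ v, Δ v ≤ H.vol Finset.univ := by
  have h := hx.2 (fun v => x v + 1) fun v => add_nonneg (hx.1 v) zero_le_one
  simp only [dualObjective, H.suppFun_add_const, mul_add, mul_one, Finset.sum_add_distrib,
    Finset.sum_sub_distrib, zero_div, zero_mul, sub_zero] at h
  unfold vol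
  linarith

/-- At a dual optimum, the sink capacity of a sweep set is at most its source mass. -/
theorem IsDualOptimal.vol_sweepSet_le {q σ : ℝ} (hq : 1 < q) (hσ : 0 ≤ σ) {Δ x : V → ℝ}
    (hx : H.IsDualOptimal q σ Δ x) {m : ℝ} (hm : 0 < m) :
    H.vol (sweepSet x m) ≤ ∑ v ∈ sweepSet x m, Δ v := by
  -- `a` is the largest value of `x` below `m`, or 0 if there is none. Lowering the sweep set by m -
  -- a cannot raise the penalty, so optimality forces its net source to be nonnegative.
  obtain ⟨a, ha0, ham, hgap⟩ : ∃ a, 0 ≤ a ∧ a < m ∧ ∀ v, x v < m → x v ≤ a := by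
    by_cases hne : (Finset.univ.filter fun v => x v < m).Nonempty
    · obtain ⟨u, hu, hmax⟩ := Finset.exists_max_image _ x hne
      exact ⟨x u, hx.1 u, (Finset.mem_filter.1 hu).2, fun v hv => hmax v (by simpa using hv)⟩
    · refine ⟨0, le_rfl, hm, fun v hv => (hne ⟨v, by simpa using hv⟩).elim⟩
  set y : V → ℝ := fun v => x v - if m ≤ x v then m - a else 0 with hy
  have hy0 : ∀ v, 0 ≤ y v := fun v => by
    simp only [hy]
    split_ifs with hv
    · linarith
    · linarith [hx.1 v]
  have hyx : ∀ v, y v ≤ x v := fun v => by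
    simp only [hy]
    split_ifs <;> linarith
  have hpen : H.penalty q σ y ≤ H.penalty q σ x := by
    refine add_le_add (Finset.sum_le_sum fun e _ => ?_)
      (mul_le_mul_of_nonneg_left (Finset.sum_le_sum fun v _ => ?_) hσ)
    · exact mul_le_mul_of_nonneg_left (Real.rpow_le_rpow (H.suppFun_nonneg e hy0)
        (H.suppFun_sub_le e hx.1 ha0 ham.le hgap) (by linarith)) (H.ϑ_pos e).le
    · exact mul_le_mul_of_nonneg_left (Real.rpow_le_rpow (hy0 v) (hyx v) (by linarith))
        (H.deg_nonneg v)
  have h1 := hx.2 y hy0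
  rw [dualObjective_eq, dualObjective_eq] at h1
  have h2 := mul_le_mul_of_nonneg_left hpen (show 0 ≤ 1 / q by positivity)
  have h3 : ∑ v, (Δ v - H.deg v) * y v = ∑ v, (Δ v - H.deg v) * x v
      - (∑ v ∈ sweepSet x m, Δ v - H.vol (sweepSet x m)) * (m - a) := by
    simp only [vol, ← Finset.sum_sub_distrib, Finset.sum_mul, sweepSet]
    rw [Finset.sum_filter, ← Finset.sum_sub_distrib]
    refine Finset.sum_congr rfl fun v _ => ?_
    simp only [hy]
    split_ifs <;> ring
  rw [h3] at h1
  have h4 : 0 ≤ (∑ v ∈ sweepSet x m, Δ v - H.vol (sweepSet x m)) * (m - a) := by linarith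
  have h5 := nonneg_of_mul_nonneg_left h4 (sub_pos.2 ham)
  linarith

/-- Every nonnegative vector has a median level. -/
theorem exists_median (H : SubmodularHypergraph V E) {x : V → ℝ} (hx : ∀ v, 0 ≤ x v) :
    ∃ m, 0 ≤ m ∧ (∀ h, m < h → H.vol (sweepSet x h) ≤ H.vol Finset.univ / 2) ∧
      ∀ h, 0 < h → h ≤ m → H.vol Finset.univ / 2 ≤ H.vol (sweepSet x h) := by
  have hν := H.vol_nonneg Finset.univ
  have hanti : ∀ {h h' : ℝ}, h ≤ h' → H.vol (sweepSet x h') ≤ H.vol (sweepSet x h) := by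
    intro h h' hle
    refine H.vol_mono fun v hv => ?_
    simp only [sweepSet, Finset.mem_filter, Finset.mem_univ, true_and] at hv ⊢
    exact hle.trans hv
  have hlevel : ∀ h, H.vol Finset.univ / 2 < H.vol (sweepSet x h) →
      ∃ v, h ≤ x v ∧ H.vol Finset.univ / 2 ≤ H.vol (sweepSet x (x v)) := by
    intro h hh
    have hne : (sweepSet x h).Nonempty := by
      rw [Finset.nonempty_iff_ne_empty]
      intro h0
      rw [h0] at hh
      simp only [vol, Finset.sum_empty] at hh hν
      linarith
    obtain ⟨u, hu, hmin⟩ := Finset.exists_min_image _ x hne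
    refine ⟨u, by simpa [sweepSet] using hu, hh.le.trans (H.vol_mono fun v hv => ?_)⟩
    simpa [sweepSet] using hmin v hv
  -- The median is the largest value of `x` whose sweep set holds at least half the volume, or 0 if
  -- no value qualifies.
  by_cases hne : (Finset.univ.filter fun v =>
      H.vol Finset.univ / 2 ≤ H.vol (sweepSet x (x v))).Nonempty
  · obtain ⟨u, hu, hmax⟩ := Finset.exists_max_image _ x hne
    refine ⟨x u, hx u, fun h hh => ?_, fun h _ hh => (Finset.mem_filter.1 hu).2.trans (hanti hh)⟩
    by_contra! hcon
    obtain ⟨v, hv, hv'⟩ := hlevel h hcon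
    exact (hh.trans_le hv).not_ge (hmax v (by simpa using hv'))
  · refine ⟨0, le_rfl, fun h hh => ?_, fun h h0 h1 => absurd h0 h1.not_gt⟩
    by_contra! hcon
    obtain ⟨v, -, hv'⟩ := hlevel h hcon
    exact hne ⟨v, by simpa using hv'⟩

end SubmodularHypergraph

/-! ### Numerical estimates. -/

/-- An identity for p = 2; for larger `p` the factor δ^(p-2) ≥ 1 is to spare. It absorbs the weight
of the nodes outside `S` when the linear part is centred at a median. -/
theorem rpow_sub_one_add_le {p δ : ℝ} (hp : 2 ≤ p) (hδ : 1 < δ) :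
    (δ - 1) ^ p + (2 * δ - 1) ≤ δ ^ p := by
  have h1 : ∀ {y : ℝ}, 0 < y → y ^ p = y ^ (p - 2) * y ^ 2 := fun hy => by
    rw [← Real.rpow_natCast, ← Real.rpow_add hy]
    norm_num
  rw [h1 (sub_pos.2 hδ), h1 (by linarith : 0 < δ)]
  have h2 : (δ - 1) ^ (p - 2) ≤ δ ^ (p - 2) :=
    Real.rpow_le_rpow (by linarith) (by linarith) (by linarith)
  have h3 : 1 ≤ δ ^ (p - 2) := Real.one_le_rpow hδ.le (by linarith)
  nlinarith [mul_le_mul_of_nonneg_right h2 (sq_nonneg (δ - 1)),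
    mul_le_mul_of_nonneg_right h3 (show 0 ≤ 2 * δ - 1 by linarith)]

/-- The numerical estimate that combines the Cheeger-type inequality with the lower bound `hN` on
the optimal value and the upper bound `hNM` in terms of the source mass. -/
theorem cheeger_estimate_false {p q Φ A s N N' M α β : ℝ} (hp : 2 ≤ p)
    (hpq : p.HolderConjugate q) (hΦ : 0 < Φ) (hA : 0 < A) (hs : 0 ≤ s) (hα : 0 < α)
    (hβ : 0 < β) (hβ1 : β ≤ 1) (hsA : β * s ≤ A) (hN' : 0 ≤ N') (hNN : N' ≤ N) (hM : 0 ≤ M)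
    (hN : 2 * A ≤ N * Φ ^ (p - 1)) (hNM : N ≤ 3 / α * (s ^ (1 / p) * M ^ (1 / q)))
    (hch : 12 * Φ ^ (1 / q) / (α * β) * M ≤ q * (N' ^ (1 / q) * M ^ (1 / p))) : False := by
  have hp0 := hpq.pos
  have hq0 := hpq.symm.pos
  have hsum : 1 / p + 1 / q = 1 := by
    rw [one_div, one_div]
    exact hpq.inv_add_inv_eq_one
  have hq2 : q ≤ 2 := by
    have h1 : 1 / p ≤ 1 / 2 := one_div_le_one_div_of_le two_pos hp
    have h2 : 1 / 2 ≤ 1 / q := by linarith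
    exact (one_div_le_one_div two_pos hq0).1 h2
  have hN0 : 0 < N := pos_of_mul_pos_left (lt_of_lt_of_le (by linarith) hN)
    (Real.rpow_nonneg hΦ.le _)
  have hM0 : 0 < M := by
    rcases hM.eq_or_lt with h | h
    · rw [← h, Real.zero_rpow hpq.symm.one_div_ne_zero] at hNM
      simp only [mul_zero] at hNM
      linarith
    · exact h
  have hsplit : ∀ {y : ℝ}, 0 < y → y = y ^ (1 / p) * y ^ (1 / q) := fun hy => by
    rw [← Real.rpow_add hy, hsum, Real.rpow_one]
  have hMp : 0 < M ^ (1 / p) := Real.rpow_pos_of_pos hM0 _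
  have hNq : 0 < N ^ (1 / q) := Real.rpow_pos_of_pos hN0 _
  have hsp : 0 ≤ s ^ (1 / p) := Real.rpow_nonneg hs _
  have h1 : 12 * Φ ^ (1 / q) / (α * β) * M ^ (1 / q) ≤ 2 * N ^ (1 / q) := by
    have h2 : q * N' ^ (1 / q) ≤ 2 * N ^ (1 / q) :=
      mul_le_mul hq2 (Real.rpow_le_rpow hN' hNN hpq.symm.one_div_nonneg)
        (Real.rpow_nonneg hN' _) two_pos.le
    refine le_trans (le_of_mul_le_mul_right ?_ hMp) h2
    calc _ = 12 * Φ ^ (1 / q) / (α * β) * (M ^ (1 / p) * M ^ (1 / q)) := by ring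
      _ = 12 * Φ ^ (1 / q) / (α * β) * M := by rw [← hsplit hM0]
      _ ≤ _ := hch
      _ = _ := by ring
  -- Eliminating `M` leaves 12 on the left against 3 · 2 on the right (from δ = 3/α and q ≤ 2). The
  -- p-th power then gives 2^p Φ^(p-1) N ≤ β^p s ≤ β s ≤ A, against `hN`.
  have h3 : 2 * (Φ ^ (1 / q) * N ^ (1 / p)) ≤ β * s ^ (1 / p) := by
    have hκ : 0 ≤ 12 * Φ ^ (1 / q) / (α * β) := by positivity
    have h4 : 12 * Φ ^ (1 / q) / (α * β) * N ≤ 3 / α * s ^ (1 / p) * (2 * N ^ (1 / q)) :=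
      calc _ ≤ 12 * Φ ^ (1 / q) / (α * β) * (3 / α * (s ^ (1 / p) * M ^ (1 / q))) :=
            mul_le_mul_of_nonneg_left hNM hκ
        _ = 3 / α * s ^ (1 / p) * (12 * Φ ^ (1 / q) / (α * β) * M ^ (1 / q)) := by ring
        _ ≤ _ := mul_le_mul_of_nonneg_left h1 (by positivity)
    have hsN := hsplit hN0
    generalize N ^ (1 / q) = b at *
    generalize N ^ (1 / p) = a at *
    rw [hsN] at h4
    have h5 : 12 * Φ ^ (1 / q) / (α * β) * a ≤ 6 / α * s ^ (1 / p) := by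
      refine le_of_mul_le_mul_right ?_ hNq
      calc _ = 12 * Φ ^ (1 / q) / (α * β) * (a * b) := by ring
        _ ≤ _ := h4
        _ = _ := by ring
    have h6 := mul_le_mul_of_nonneg_left h5 (show 0 ≤ α * β / 6 by positivity)
    field_simp at h6
    linarith
  have h7 := Real.rpow_le_rpow (by positivity) h3 hp0.le
  have hroot : ∀ {y : ℝ}, 0 ≤ y → (y ^ (1 / p)) ^ p = y := fun hy => by
    rw [← Real.rpow_mul hy, one_div_mul_cancel hpq.ne_zero, Real.rpow_one]
  have hΦp : (Φ ^ (1 / q)) ^ p = Φ ^ (p - 1) := by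
    rw [← Real.rpow_mul hΦ.le, one_div_mul_eq_div, hpq.div_conj_eq_sub_one]
  rw [Real.mul_rpow two_pos.le (by positivity), Real.mul_rpow (by positivity) (by positivity),
    Real.mul_rpow hβ.le hsp, hroot hN0.le, hroot hs, hΦp] at h7
  have h8 : (1 : ℝ) ≤ 2 ^ p := Real.one_le_rpow one_le_two hp0.le
  have h9 : β ^ p ≤ β := Real.rpow_le_self_of_le_one hβ.le hβ1 (by linarith)
  have h10 : 0 ≤ Φ ^ (p - 1) * N := by positivity
  nlinarith [mul_le_mul_of_nonneg_right h8 h10, mul_le_mul_of_nonneg_right h9 hs]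

/-! ### Lower and upper bounds for the penalty at the optimum. -/

namespace SubmodularHypergraph

variable {V E : Type*} [Fintype V] [DecidableEq V] [Fintype E] {H : SubmodularHypergraph V E}

theorem penalty_nonneg {q σ : ℝ} (hσ : 0 ≤ σ) {x : V → ℝ} (hx : ∀ v, 0 ≤ x v) :
    0 ≤ H.penalty q σ x :=
  add_nonneg (Finset.sum_nonneg fun e _ =>
      mul_nonneg (H.ϑ_pos e).le (Real.rpow_nonneg (H.suppFun_nonneg e hx) _))
    (mul_nonneg hσ (Finset.sum_nonneg fun v _ =>
      mul_nonneg (H.deg_nonneg v) (Real.rpow_nonneg (hx v) _)))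

/-- If the source mass in `C` exceeds its sink capacity by `2 vol C`, then existence of a dual
optimum forces `Φ > 0` and gives a lower bound on the penalty. -/
theorem IsDualOptimal.penalty_lower_bound {p q σ Φ : ℝ} (hpq : p.HolderConjugate q)
    {Δ x : V → ℝ} (hx : H.IsDualOptimal q σ Δ x) {C : Finset V} (hC : 0 < H.vol C)
    (hσ : 0 ≤ σ) (hΔ : 2 * H.vol C ≤ ∑ v ∈ C, (Δ v - H.deg v)) (hΦ : 0 ≤ Φ)
    (hcut : H.cutSize C ≤ Φ * H.vol C) (hσΦ : σ ≤ Φ / 3) :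
    0 < Φ ∧ 2 * H.vol C ≤ H.penalty q σ x * Φ ^ (p - 1) := by
  have hp0 := hpq.pos
  have hp1 := hpq.lt
  set A := H.vol C
  set N := H.penalty q σ x
  have hN : 0 ≤ N := penalty_nonneg hσ hx.1
  have key : ∀ t : ℝ, 0 ≤ t → 2 * t * A - 4 / 3 * (1 / q) * (t ^ q * Φ * A) ≤ 1 / p * N := by
    intro t ht
    have h1 := hx.indicator_le hpq C ht
    have h2 := mul_le_mul_of_nonneg_left hΔ ht
    have h3 : H.cutSize C + σ * A ≤ 4 / 3 * (Φ * A) := by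
      have := mul_le_mul_of_nonneg_right hσΦ hC.le
      linarith
    have h4 := mul_le_mul_of_nonneg_left
      (mul_le_mul_of_nonneg_left h3 (Real.rpow_nonneg ht q)) hpq.symm.one_div_nonneg
    linarith
  -- For Φ = 0 the left side of `key` would grow linearly in `t`.
  have hΦ0 : 0 < Φ := by
    refine hΦ.lt_of_ne fun h0 => ?_
    have hpN : 0 ≤ 1 / p * N := by positivity
    have h1 := key (1 / p * N / (2 * A) + 1) (by positivity)
    rw [← h0] at h1
    simp only [mul_zero, zero_mul, sub_zero] at h1
    have h2 : 2 * (1 / p * N / (2 * A) + 1) * A = 1 / p * N + 2 * A := by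
      field_simp
    linarith
  refine ⟨hΦ0, ?_⟩
  -- This `t` satisfies t^q Φ = t, as (p - 1) q = p. It yields N Φ^(p-1) ≥ (2p/3 + 4/3) A, which
  -- exceeds 2A.
  have h1 := key (Φ ^ (-(p - 1))) (Real.rpow_nonneg hΦ _)
  have h2 : (Φ ^ (-(p - 1))) ^ q * Φ = Φ ^ (-(p - 1)) := by
    nth_rw 2 [← Real.rpow_one Φ]
    rw [← Real.rpow_mul hΦ, ← Real.rpow_add hΦ0]
    congr 1
    have := hpq.sub_one_mul_conj
    linarith
  rw [h2] at h1
  have h3 : Φ ^ (-(p - 1)) * Φ ^ (p - 1) = 1 := by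
    rw [← Real.rpow_add hΦ0, neg_add_cancel, Real.rpow_zero]
  have hu : 0 < Φ ^ (p - 1) := Real.rpow_pos_of_pos hΦ0 _
  have h4 := mul_le_mul_of_nonneg_right h1 hu.le
  have h5 : 2 * A - 4 / 3 * (1 / q) * A ≤ 1 / p * (N * Φ ^ (p - 1)) := by
    calc _ = 2 * (Φ ^ (-(p - 1)) * Φ ^ (p - 1)) * A
          - 4 / 3 * (1 / q) * ((Φ ^ (-(p - 1)) * Φ ^ (p - 1)) * A) := by rw [h3]; ring
      _ = (2 * Φ ^ (-(p - 1)) * A - 4 / 3 * (1 / q) * (Φ ^ (-(p - 1)) * A)) * Φ ^ (p - 1) := by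
        ring
      _ ≤ _ := h4
      _ = _ := by ring
  have h6 : 1 / q = 1 - 1 / p := by
    rw [one_div, one_div]
    linarith [hpq.inv_add_inv_eq_one]
  rw [h6] at h5
  have h7 := mul_le_mul_of_nonneg_left h5 hp0.le
  have h8 : p * (1 / p * (N * Φ ^ (p - 1))) = N * Φ ^ (p - 1) := by field_simp
  have h9 : p * (2 * A - 4 / 3 * (1 - 1 / p) * A) = (2 / 3 * p + 4 / 3) * A := by
    field_simp
    ring
  rw [h8, h9] at h7
  nlinarith

theorem sum_source_eq (S : Finset V) (δ : ℝ) : ∑ v, H.source S δ v = δ * H.vol S := by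
  simp [source, vol, Finset.mul_sum]

/-- Hölder bound for the linear part of the dual objective, centred at level `m`. -/
theorem linear_le_of_weights {p q : ℝ} (hpq : p.HolderConjugate q) {a x : V → ℝ} {L m δ s : ℝ}
    (ha : ∀ v, 0 ≤ a v) (hδ : 0 ≤ δ) (hs : 0 ≤ s)
    (hL : L ≤ ∑ v, H.deg v * (a v * |x v - m|)) (has : ∑ v, H.deg v * a v ^ p ≤ δ ^ p * s) :
    L ≤ δ * (s ^ (1 / p) * (∑ v, H.deg v * |x v - m| ^ q) ^ (1 / q)) := by
  have h1 := sum_weight_mul_le_Lp_mul_Lq hpq (w := H.deg) (a := a) (b := fun v => |x v - m|)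
    H.deg_nonneg ha fun v => abs_nonneg _
  have h2 : (∑ v, H.deg v * a v ^ p) ^ (1 / p) ≤ δ * s ^ (1 / p) := by
    refine (Real.rpow_le_rpow (Finset.sum_nonneg fun v _ =>
      mul_nonneg (H.deg_nonneg v) (Real.rpow_nonneg (ha v) _)) has hpq.one_div_nonneg).trans_eq ?_
    rw [Real.mul_rpow (Real.rpow_nonneg hδ _) hs, ← Real.rpow_mul hδ,
      mul_one_div_cancel hpq.ne_zero, Real.rpow_one]
  rw [← mul_assoc]
  exact (hL.trans h1).trans (mul_le_mul_of_nonneg_right h2 (Real.rpow_nonneg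
    (Finset.sum_nonneg fun v _ => mul_nonneg (H.deg_nonneg v)
      (Real.rpow_nonneg (abs_nonneg _) _)) _))

theorem linear_source_le_of_zero {p q : ℝ} (hpq : p.HolderConjugate q) {x : V → ℝ}
    (hx : ∀ v, 0 ≤ x v) (S : Finset V) {δ : ℝ} (hδ : 0 ≤ δ) :
    ∑ v, (H.source S δ v - H.deg v) * x v
      ≤ δ * (H.vol S ^ (1 / p) * (∑ v, H.deg v * |x v - 0| ^ q) ^ (1 / q)) := by
  refine linear_le_of_weights hpq (a := fun v => if v ∈ S then δ else 0) (fun v => ?_) hδ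
    (H.vol_nonneg S) (Finset.sum_le_sum fun v _ => ?_) (le_of_eq ?_)
  · split_ifs <;> simp [hδ]
  · rw [sub_zero, abs_of_nonneg (hx v), source]
    have := mul_nonneg (H.deg_nonneg v) (hx v)
    split_ifs <;> nlinarith
  · simp [apply_ite (fun y : ℝ => y ^ p), Real.zero_rpow hpq.ne_zero, vol, Finset.mul_sum,
      mul_comm]

/-- Replacing `x` by x - m changes the linear part by `m` times source minus capacity, which is at
most 0. The weights become δ - 1 on `S` and 1 off `S`; `hvol` gives vol(Sᶜ) ≤ (2δ - 1) vol(S), so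
their p-th powers still sum to at most δ^p vol(S). -/
theorem linear_source_le_of_mass_le {p q : ℝ} (hp : 2 ≤ p) (hpq : p.HolderConjugate q)
    {x : V → ℝ} (S : Finset V) {δ m : ℝ} (hδ : 1 < δ) (hm : 0 ≤ m)
    (hmass : δ * H.vol S ≤ H.vol Finset.univ) (hvol : H.vol Finset.univ ≤ 2 * (δ * H.vol S)) :
    ∑ v, (H.source S δ v - H.deg v) * x v
      ≤ δ * (H.vol S ^ (1 / p) * (∑ v, H.deg v * |x v - m| ^ q) ^ (1 / q)) := by
  refine linear_le_of_weights hpq (a := fun v => if v ∈ S then δ - 1 else 1) (fun v => ?_)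
    (by linarith) (H.vol_nonneg S) ?_ ?_
  · split_ifs <;> linarith
  · have h1 : ∑ v, (H.source S δ v - H.deg v) * x v
        = ∑ v, (H.source S δ v - H.deg v) * (x v - m)
          + m * (δ * H.vol S - H.vol Finset.univ) := by
      rw [← sum_source_eq, vol, ← Finset.sum_sub_distrib, Finset.mul_sum,
        ← Finset.sum_add_distrib]
      exact Finset.sum_congr rfl fun v _ => by ring
    have h2 : m * (δ * H.vol S - H.vol Finset.univ) ≤ 0 :=
      mul_nonpos_of_nonneg_of_nonpos hm (by linarith)
    have h3 : ∑ v, (H.source S δ v - H.deg v) * (x v - m)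
        ≤ ∑ v, H.deg v * ((if v ∈ S then δ - 1 else 1) * |x v - m|) := by
      refine Finset.sum_le_sum fun v _ => ?_
      rw [source]
      have hd := H.deg_nonneg v
      split_ifs
      · have := mul_le_mul_of_nonneg_left (le_abs_self (x v - m))
          (mul_nonneg hd (by linarith : 0 ≤ δ - 1))
        linarith
      · have := mul_le_mul_of_nonneg_left (neg_le_abs (x v - m)) hd
        linarith
    linarith
  · have h1 : ∑ v, H.deg v * (if v ∈ S then δ - 1 else 1) ^ p
        = (δ - 1) ^ p * H.vol S + H.vol Sᶜ := by
      rw [← Finset.sum_add_sum_compl S, vol, vol, Finset.mul_sum]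
      congr 1
      · refine Finset.sum_congr rfl fun v hv => ?_
        rw [if_pos hv, mul_comm]
      · refine Finset.sum_congr rfl fun v hv => ?_
        rw [if_neg (Finset.mem_compl.1 hv), Real.one_rpow, mul_one]
    rw [h1]
    have h2 := H.vol_add_compl S
    have h3 := mul_le_mul_of_nonneg_right (rpow_sub_one_add_le hp hδ) (H.vol_nonneg S)
    linarith

end SubmodularHypergraph

/-! ### The main theorem. -/

open SubmodularHypergraph in
theorem theorem1 {V E : Type*} [Fintype V] [DecidableEq V] [Fintype E]
    (H : SubmodularHypergraph V E)
    (p q : ℝ) (hp : 2 ≤ p) (hpq : p.HolderConjugate q)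
    (S C : Finset V) (hC : 0 < H.vol C) (hC' : 0 < H.vol Cᶜ)
    (α β δ σ : ℝ) (hα : 0 < α) (hα1 : α ≤ 1) (hβ : 0 < β) (hβ1 : β ≤ 1)
    (hSα : α * H.vol C ≤ H.vol (S ∩ C)) (hSβ : β * H.vol S ≤ H.vol (S ∩ C))
    (hδ : δ = 3 / α)
    (hσ : 0 ≤ σ) (hσΦ : σ ≤ β * H.conductance C / 3)
    (x : V → ℝ) (hx : H.IsDualOptimal q σ (H.source S δ) x) :
    ∃ h : ℝ, 0 < h ∧ 0 < H.vol (sweepSet x h) ∧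
      H.cutSize (sweepSet x h) / H.vol (sweepSet x h)
        ≤ 12 * H.conductance C ^ (1 / q) / (α * β) ∧
      ((σ = 0 ∨ ∑ v, H.source S δ v ≤ H.vol Finset.univ) →
        0 < H.vol (sweepSet x h)ᶜ ∧
        H.conductance (sweepSet x h) ≤ 12 * H.conductance C ^ (1 / q) / (α * β)) := by
  have hq := hpq.symm.lt
  have hδ3 : 3 ≤ δ := by
    rw [hδ, le_div_iff₀ hα]
    linarith
  have hmin : 0 < min (H.vol C) (H.vol Cᶜ) := lt_min hC hC'
  have hΦnn : 0 ≤ H.conductance C := div_nonneg (H.cutSize_nonneg C) hmin.le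
  have hcut : H.cutSize C ≤ H.conductance C * H.vol C := by
    have h1 : H.cutSize C = H.conductance C * min (H.vol C) (H.vol Cᶜ) :=
      (div_mul_cancel₀ _ hmin.ne').symm
    rw [h1]
    exact mul_le_mul_of_nonneg_left (min_le_left _ _) hΦnn
  set Φ := H.conductance C
  -- The choice δ = 3/α puts source mass at least 3 vol(C) on `C`; its sinks absorb one vol(C).
  have hΔ : 2 * H.vol C ≤ ∑ v ∈ C, (H.source S δ v - H.deg v) := by
    have h1 : ∑ v ∈ C, (H.source S δ v - H.deg v) = δ * H.vol (S ∩ C) - H.vol C := by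
      rw [Finset.sum_sub_distrib]
      simp only [source, ← Finset.sum_filter, ← Finset.mul_sum, vol]
      rw [Finset.filter_mem_eq_inter, Finset.inter_comm]
    have h2 : δ * (α * H.vol C) = 3 * H.vol C := by
      rw [hδ]
      field_simp
    have h3 := mul_le_mul_of_nonneg_left hSα (by linarith : 0 ≤ δ)
    linarith
  obtain ⟨hΦ, hN⟩ := hx.penalty_lower_bound hpq hC hσ hΔ hΦnn hcut
    (hσΦ.trans (by nlinarith))
  set κ := 12 * Φ ^ (1 / q) / (α * β) with hκdef
  have hκ : 0 < κ := by positivity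
  have hlin := hx.linear_eq_penalty hq
  have hlevel : ∀ m, 0 ≤ m → ∑ v, (H.source S δ v - H.deg v) * x v
      ≤ δ * (H.vol S ^ (1 / p) * (∑ v, H.deg v * |x v - m| ^ q) ^ (1 / q)) →
      ∃ h, 0 < h ∧ ((h ≤ m ∧ H.cutSize (sweepSet x h) < κ * H.vol (sweepSet x h)ᶜ) ∨
        (m < h ∧ H.cutSize (sweepSet x h) < κ * H.vol (sweepSet x h))) := by
    intro m hm hNM
    by_contra! hcon
    have hch := H.cheeger_sweep hpq hx.1 hm (fun h h0 h1 => (hcon h h0).1 h1)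
      (fun h h1 => (hcon h (hm.trans_lt h1)).2 h1)
    rw [hlin, hδ] at hNM
    have hsA : β * H.vol S ≤ H.vol C := hSβ.trans (H.vol_mono Finset.inter_subset_right)
    refine cheeger_estimate_false hp hpq hΦ hC (H.vol_nonneg S) hα hβ hβ1 hsA
      (Finset.sum_nonneg fun e _ =>
        mul_nonneg (H.ϑ_pos e).le (Real.rpow_nonneg (H.suppFun_nonneg e hx.1) _))
      (le_add_of_nonneg_right (mul_nonneg hσ (Finset.sum_nonneg fun v _ =>
        mul_nonneg (H.deg_nonneg v) (Real.rpow_nonneg (hx.1 v) _))))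
      (Finset.sum_nonneg fun v _ =>
        mul_nonneg (H.deg_nonneg v) (Real.rpow_nonneg (abs_nonneg _) _)) hN hNM hch
  have hpos : ∀ {A B : Finset V}, H.cutSize A < κ * H.vol B → 0 < H.vol B := fun {A B} h =>
    pos_of_mul_pos_right ((H.cutSize_nonneg A).trans_lt h) hκ.le
  by_cases hcase : σ = 0 ∨ ∑ v, H.source S δ v ≤ H.vol Finset.univ
  · have hmass : δ * H.vol S ≤ H.vol Finset.univ := by
      rw [← sum_source_eq]
      rcases hcase with h0 | h0
      · rw [h0] at hx
        exact hx.sum_source_le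
      · exact h0
    have hν : 0 < H.vol Finset.univ := hC.trans_le (H.vol_mono (Finset.subset_univ C))
    obtain ⟨m, hm, hhigh, hlow⟩ := H.exists_median hx.1
    have hNM : ∑ v, (H.source S δ v - H.deg v) * x v
        ≤ δ * (H.vol S ^ (1 / p) * (∑ v, H.deg v * |x v - m| ^ q) ^ (1 / q)) := by
      -- For m > 0, half the total volume lies in S_m, whose volume is at most its source mass,
      -- hence at most δ vol(S).
      rcases hm.eq_or_lt with h0 | h0
      · rw [← h0]
        exact linear_source_le_of_zero hpq hx.1 S (by linarith)
      · refine linear_source_le_of_mass_le hp hpq S (by linarith) hm hmass ?_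
        have h1 := hlow m h0 le_rfl
        have h2 := hx.vol_sweepSet_le hq hσ h0
        have h3 : ∑ v ∈ sweepSet x m, H.source S δ v ≤ ∑ v, H.source S δ v := by
          refine Finset.sum_le_sum_of_subset_of_nonneg (Finset.subset_univ _) fun v _ _ => ?_
          rw [source]
          split_ifs
          · exact mul_nonneg (by linarith) (H.deg_nonneg v)
          · exact le_rfl
        rw [sum_source_eq] at h3
        linarith
    obtain ⟨h, h0, hh⟩ := hlevel m hm hNM
    have hadd := H.vol_add_compl (sweepSet x h)
    have hfin : 0 < H.vol (sweepSet x h) ∧ 0 < H.vol (sweepSet x h)ᶜ ∧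
        H.cutSize (sweepSet x h)
          ≤ κ * min (H.vol (sweepSet x h)) (H.vol (sweepSet x h)ᶜ) := by
      rcases hh with ⟨hle, hlt⟩ | ⟨hlt', hlt⟩
      · have h1 := hlow h h0 hle
        exact ⟨by linarith, hpos hlt, by rw [min_eq_right (by linarith)]; exact hlt.le⟩
      · have h1 := hhigh h hlt'
        exact ⟨hpos hlt, by linarith, by rw [min_eq_left (by linarith)]; exact hlt.le⟩
    obtain ⟨hv, hv', hc⟩ := hfin
    refine ⟨h, h0, hv, ?_, fun _ => ⟨hv', ?_⟩⟩
    · rw [div_le_iff₀ hv]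
      exact hc.trans (mul_le_mul_of_nonneg_left (min_le_left _ _) hκ.le)
    · rw [conductance, div_le_iff₀ (lt_min hv hv')]
      exact hc
  -- With m = 0 the alternative h ≤ m is void, so the violation is relative to vol(S_h).
  · obtain ⟨h, h0, hh⟩ := hlevel 0 le_rfl
      (linear_source_le_of_zero hpq hx.1 S (by linarith))
    have hlt : H.cutSize (sweepSet x h) < κ * H.vol (sweepSet x h) := by
      rcases hh with ⟨hle, -⟩ | ⟨-, hlt⟩
      · exact absurd h0 hle.not_gt
      · exact hlt
    refine ⟨h, h0, hpos hlt, ?_, fun hc => absurd hc hcase⟩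
    rw [div_le_iff₀ (hpos hlt)]
    exact hlt.le
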